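/- Conventions. A simplex is \emph{nonobtuse} if none of the dihedral angles between its facets exceeds $\pi/2$ (for a triangle: none of its angles exceeds $\pi/2$). The \emph{sub-orthocentric set} $\Delta_\ast$ of a nonobtuse triangle $\Delta$ is the union of the three line segments between a vertex of $\Delta$ and its orthocenter. A tetrahedron with nonobtuse triangular facets is \emph{sub-orthocentric} if each of its vertices projects orthogonally onto a point of the sub-orthocentric set of its opposite facet. Let $\boxslash$ be a nonobtuse tetrahedron with vertices $p_0,\dots,p_3$ and opposite triangular facets $\Delta_0,\dots,\Delta_3$, and let $\pi_j$ be the orthogonal projection of $p_j$ onto the plane containing $\Delta_j$. For $\ell\in\{0,1,2,3\}$ put $$\boxslash_\ell=\bigcap_{j\neq \ell}\operatorname{conv}(\{\pi_j\}\cup\Delta_\ell).$$ The \emph{sub-orthocentric set} of $\boxslash$ is $$\boxslash_\ast=\boxslash\setminus\bigcup_{\ell}\bigl(\operatorname{int}(\boxslash_\ell)\cup\operatorname{int}(\Delta_\ell)\bigr),$$ where the union is over those $\ell\in\{0,1,2,3\}$ for which $\operatorname{int}(\boxslash_\ell)\neq\emptyset$; here $\operatorname{int}(\boxslash_\ell)$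 is the interior relative to the three-dimensional affine hull of $\boxslash$, and $\operatorname{int}(\Delta_\ell)$ is the relative interior of the triangle $\Delta_\ell$. A $4$-simplex with nonobtuse tetrahedral facets is \emph{sub-orthocentric} if each of its vertices projects orthogonally onto a point of the sub-orthocentric set of its opposite tetrahedral facet. Theorem. Every $4$-simplex all of whose tetrahedral facets are sub-orthocentric is itself sub-orthocentric. -/

import Mathlib

noncomputable section

namespace SubOrthocentric

variable {E : Type*} [NormedAddCommGroup E] [InnerProductSpace ℝ E]

/-- The facet of an `(n+1)`-simplex opposite its `i`-th vertex, as an `n`-simplex. -/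
abbrev facet {n : ℕ} (S : Affine.Simplex ℝ E (n + 1)) (i : Fin (n + 2)) : Affine.Simplex ℝ E n :=
  S.faceOpposite i

/-- The dihedral angle between the facets opposite the vertices `i` and `j`: the supplement of the
angle between the inward normals to these facets (within the affine span of the simplex). The vector
from the foot of the altitude to the vertex is such an inward normal. For a triangle this is
the angle between two of its sides. -/
def dihedralAngle {n : ℕ} [NeZero n] (S : Affine.Simplex ℝ E n) (i j : Fin (n + 1)) : ℝ :=
  Real.pi - InnerProductGeometry.angle
    (S.points i - S.altitudeFoot i) (S.points j - S.altitudeFoot j)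

/-- A simplex is nonobtuse if none of its dihedral angles exceeds `π / 2`. -/
def IsNonobtuse {n : ℕ} [NeZero n] (S : Affine.Simplex ℝ E n) : Prop :=
  ∀ i j : Fin (n + 1), i ≠ j → dihedralAngle S i j ≤ Real.pi / 2

/-- The sub-orthocentric points of a (nonobtuse) triangle: the convex combinations of a vertex
and the orthocenter. -/
def triangleSubOrthocentricSet (Δ : Affine.Simplex ℝ E 2) : Set E :=
  ⋃ i : Fin 3, segment ℝ (Δ.points i) (Affine.Triangle.orthocenter Δ)

/-- A tetrahedron with nonobtuse triangular facets is sub-orthocentric if each altitude meets the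
opposite facet in a sub-orthocentric point of that facet. -/
def IsSubOrthocentricTetrahedron (T : Affine.Simplex ℝ E 3) : Prop :=
  (∀ i, IsNonobtuse (facet T i)) ∧
    ∀ i, T.altitudeFoot i ∈ triangleSubOrthocentricSet (facet T i)

/-- The convex hull of the foot of the altitude from the `j`-th vertex of the tetrahedron `T` and
the facet opposite the `l`-th vertex (possibly degenerate). -/
def subTetrahedron (T : Affine.Simplex ℝ E 3) (j l : Fin 4) : Set E :=
  convexHull ℝ (insert (T.altitudeFoot j) (Set.range (facet T l).points))

/-- The intersection of the three sub-tetrahedra `subTetrahedron T j l`, `j ≠ l`, on the facet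
opposite the `l`-th vertex. -/
def coreTetrahedron (T : Affine.Simplex ℝ E 3) (l : Fin 4) : Set E :=
  ⋂ (j : Fin 4) (_ : j ≠ l), subTetrahedron T j l

/-- The interior of a set relative to the 3-dimensional affine span of the tetrahedron `T`. In
contrast to `intrinsicInterior`, it is empty for lower-dimensional sets. -/
def interiorIn (T : Affine.Simplex ℝ E 3) (A : Set E) : Set E :=
  Subtype.val '' interior
    (Subtype.val ⁻¹' A : Set (affineSpan ℝ (Set.range T.points)))

/-- The sub-orthocentric set of a (nonobtuse) tetrahedron `T`: for each `l` such that
`coreTetrahedron T l` has nonempty interior, both that interior and the (relative) interior of the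
facet opposite the `l`-th vertex are removed from `T`. -/
def tetrahedronSubOrthocentricSet (T : Affine.Simplex ℝ E 3) : Set E :=
  T.closedInterior \
    ⋃ (l : Fin 4) (_ : (interiorIn T (coreTetrahedron T l)).Nonempty),
      (interiorIn T (coreTetrahedron T l) ∪ (facet T l).interior)

/-- A 4-simplex with nonobtuse tetrahedral facets is sub-orthocentric if each vertex projects
orthogonally on a sub-orthocentric point of its opposite facet. -/
def IsSubOrthocentricFourSimplex (S : Affine.Simplex ℝ E 4) : Prop :=
  (∀ i, IsNonobtuse (facet S i)) ∧
    ∀ i, S.altitudeFoot i ∈ tetrahedronSubOrthocentricSet (facet S i)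

end SubOrthocentric

end

/-! Everything is expressed by the weights w_ij = -⟨g_i, g_j⟩, where g_i is the gradient of the i-th
barycentric coordinate. A simplex is nonobtuse iff w_ij ≥ 0 for i ≠ j (`isNonobtuse_iff`), the foot
of the m-th altitude has coordinates w_mi / |g_m|² for i ≠ m (`bary_altitudeFoot`), and the facet
opposite m has weights w_ij + w_im w_jm / |g_m|² (`weight_facet`).

In a sub-orthocentric tetrahedron, weights are nonnegative and none of the three products w_ij w_kl
over opposite edges is strictly smaller than both others
(`IsSubOrthocentricTetrahedron.weight_mul_weight_le`).

For a 4-simplex with such facets, `not_forall_weight_mul_lt` shows that no edge ij can satisfy w_ij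
w_xy < w_ix w_jy for all other x ≠ y, under mild sign conditions. This is used twice. A negative
w_ij would be such an edge, so all weights are nonnegative and each foot lies in its facet. If the
foot from m lay in the part removed near the l-th face of its facet, then the edge from m to that
l-th vertex would be such an edge. -/

open scoped RealInnerProductSpace

namespace SubOrthocentric

variable {E : Type*} [NormedAddCommGroup E] [InnerProductSpace ℝ E]

/-! ### Barycentric gradients and weights. -/

section Gradient

variable {n : ℕ} [NeZero n] (S : Affine.Simplex ℝ E n)

/-- The gradient of the `i`-th barycentric coordinate of a simplex. -/
noncomputable def grad (i : Fin (n + 1)) : E :=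
  (‖S.points i - S.altitudeFoot i‖ ^ 2)⁻¹ • (S.points i - S.altitudeFoot i)

/-- The weight of the edge between the `i`-th and the `j`-th vertex: minus the inner product of the
gradients of the barycentric coordinates. -/
noncomputable def weight (i j : Fin (n + 1)) : ℝ := -⟪grad S i, grad S j⟫

/-- The `j`-th barycentric coordinate, extended to an affine function on the whole space. -/
noncomputable def bary (j : Fin (n + 1)) (x : E) : ℝ := 1 + ⟪grad S j, x - S.points j⟫

lemma norm_sub_altitudeFoot_pos (i : Fin (n + 1)) : 0 < ‖S.points i - S.altitudeFoot i‖ :=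
  norm_pos_iff.2 (sub_ne_zero.2 (S.ne_altitudeFoot i))

lemma weight_comm (i j : Fin (n + 1)) : weight S i j = weight S j i := by
  rw [weight, weight, real_inner_comm]

lemma inner_grad_self (i : Fin (n + 1)) :
    ⟪grad S i, grad S i⟫ = (‖S.points i - S.altitudeFoot i‖ ^ 2)⁻¹ := by
  have := (norm_sub_altitudeFoot_pos S i).ne'
  rw [grad, real_inner_smul_left, real_inner_smul_right, real_inner_self_eq_norm_sq]
  field_simp

lemma inner_grad_self_pos (i : Fin (n + 1)) : 0 < ⟪grad S i, grad S i⟫ := by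
  have := norm_sub_altitudeFoot_pos S i
  rw [inner_grad_self]
  positivity

lemma sub_altitudeFoot_eq (i : Fin (n + 1)) :
    S.points i - S.altitudeFoot i = ⟪grad S i, grad S i⟫⁻¹ • grad S i := by
  have := (norm_sub_altitudeFoot_pos S i).ne'
  rw [inner_grad_self, grad, smul_smul, inv_inv, mul_inv_cancel₀ (by positivity), one_smul]

lemma inner_grad_sub_of_ne {i j : Fin (n + 1)} (h : i ≠ j) :
    ⟪grad S i, S.points i - S.points j⟫ = 1 := by
  have h1 := S.inner_vsub_vsub_altitudeFoot_eq_height_sq h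
  simp only [vsub_eq_sub, Affine.Simplex.height, dist_eq_norm] at h1
  have := (norm_sub_altitudeFoot_pos S i).ne'
  rw [grad, real_inner_smul_left, real_inner_comm, h1]
  field_simp

lemma inner_grad_sub (i j k : Fin (n + 1)) :
    ⟪grad S i, S.points j - S.points k⟫ =
      (if i = j then 1 else 0) - (if i = k then 1 else 0) := by
  have key : ∀ l, ⟪grad S i, S.points l - S.points i⟫ = (if i = l then 1 else 0) - 1 := by
    intro l
    split_ifs with h
    · simp [h]
    · rw [← neg_sub (S.points i), inner_neg_right, inner_grad_sub_of_ne S h]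
      simp
  have : S.points j - S.points k =
      (S.points j - S.points i) - (S.points k - S.points i) := by abel
  rw [this, inner_sub_right, key, key]
  ring

lemma grad_mem_vectorSpan (i : Fin (n + 1)) : grad S i ∈ vectorSpan ℝ (Set.range S.points) := by
  refine Submodule.smul_mem _ _ ?_
  rw [← direction_affineSpan]
  exact AffineSubspace.vsub_mem_direction (mem_affineSpan ℝ (Set.mem_range_self _))
    (S.altitudeFoot_mem_affineSpan i)

/-- The ambient space may be larger than the span of the simplex, so identities between gradients
are tested on edge vectors within that span. -/
lemma inner_eq_zero_of_mem_vectorSpan {ι : Type*} {p : ι → E} {u v : E}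
    (hv : v ∈ vectorSpan ℝ (Set.range p)) (h : ∀ a b, ⟪u, p a - p b⟫ = 0) : ⟪u, v⟫ = 0 := by
  have : vectorSpan ℝ (Set.range p) ≤ (ℝ ∙ u)ᗮ := by
    rw [vectorSpan_def, Submodule.span_le]
    rintro _ ⟨_, ⟨a, rfl⟩, _, ⟨b, rfl⟩, rfl⟩
    exact Submodule.mem_orthogonal_singleton_iff_inner_right.2 (h a b)
  exact Submodule.mem_orthogonal_singleton_iff_inner_right.1 (this hv)

lemma eq_zero_of_mem_vectorSpan {ι : Type*} {p : ι → E} {v : E}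
    (hv : v ∈ vectorSpan ℝ (Set.range p)) (h : ∀ a b, ⟪v, p a - p b⟫ = 0) : v = 0 :=
  inner_self_eq_zero.1 (inner_eq_zero_of_mem_vectorSpan hv h)

lemma sum_grad : ∑ i, grad S i = 0 := by
  refine eq_zero_of_mem_vectorSpan (Submodule.sum_mem _ fun i _ ↦ grad_mem_vectorSpan S i) ?_
  intro a b
  simp [sum_inner, inner_grad_sub, Finset.sum_sub_distrib]

lemma isNonobtuse_iff : IsNonobtuse S ↔ ∀ i j, i ≠ j → 0 ≤ weight S i j := by
  refine forall_congr' fun i ↦ forall_congr' fun j ↦ imp_congr_right fun _ ↦ ?_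
  have hi := norm_sub_altitudeFoot_pos S i
  have hj := norm_sub_altitudeFoot_pos S j
  have h1 : dihedralAngle S i j ≤ Real.pi / 2 ↔
      ⟪S.points i - S.altitudeFoot i, S.points j - S.altitudeFoot j⟫ ≤ 0 := by
    rw [dihedralAngle, InnerProductGeometry.angle, ← Real.arccos_neg, Real.arccos_le_pi_div_two,
      neg_nonneg]
    constructor
    · intro h
      by_contra! h'
      exact absurd h (not_le.2 (by positivity))
    · intro h
      exact div_nonpos_of_nonpos_of_nonneg h (by positivity)
  rw [h1, weight, grad, grad, real_inner_smul_left, real_inner_smul_right, neg_nonneg, ← mul_assoc]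
  have : 0 < (‖S.points i - S.altitudeFoot i‖ ^ 2)⁻¹ * (‖S.points j - S.altitudeFoot j‖ ^ 2)⁻¹ := by
    positivity
  constructor
  · exact fun h ↦ mul_nonpos_of_nonneg_of_nonpos this.le h
  · intro h
    by_contra! h'
    exact absurd h (not_le.2 (mul_pos this h'))

lemma bary_point (j k : Fin (n + 1)) : bary S j (S.points k) = if j = k then 1 else 0 := by
  rw [bary, inner_grad_sub]
  simp

lemma bary_add_smul (j : Fin (n + 1)) (x v : E) (t : ℝ) :
    bary S j (x + t • v) = bary S j x + t * ⟪grad S j, v⟫ := by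
  rw [bary, bary, add_sub_right_comm, inner_add_right, real_inner_smul_right]
  ring

lemma bary_combo (j : Fin (n + 1)) (x y : E) {a b : ℝ} (h : a + b = 1) :
    bary S j (a • x + b • y) = a * bary S j x + b * bary S j y := by
  have : a • x + b • y = x + b • (y - x) := by
    rw [← eq_sub_iff_add_eq] at h
    rw [h]
    module
  rw [this, bary_add_smul]
  have h2 : y - x = (y - S.points j) - (x - S.points j) := by abel
  rw [h2, inner_sub_right, bary, bary]
  obtain rfl : a = 1 - b := by linarith
  ring

lemma bary_affineCombination (j : Fin (n + 1)) {w : Fin (n + 1) → ℝ} (hw : ∑ i, w i = 1) :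
    bary S j (Finset.univ.affineCombination ℝ S.points w) = w j := by
  have h : ∑ i, w i • S.points i - S.points j = ∑ i, w i • (S.points i - S.points j) := by
    simp [smul_sub, Finset.sum_sub_distrib, ← Finset.sum_smul, hw]
  rw [Finset.affineCombination_eq_linear_combination _ _ _ hw, bary, h, inner_sum]
  simp [real_inner_smul_right, inner_grad_sub, mul_sub, Finset.sum_sub_distrib, hw]

lemma sum_bary {x : E} (hx : x ∈ affineSpan ℝ (Set.range S.points)) : ∑ j, bary S j x = 1 := by
  obtain ⟨w, hw, rfl⟩ := eq_affineCombination_of_mem_affineSpan_of_fintype hx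
  simp_rw [bary_affineCombination S _ hw, hw]

lemma mem_closedInterior_of_bary_nonneg {x : E} (hx : x ∈ affineSpan ℝ (Set.range S.points))
    (h : ∀ j, 0 ≤ bary S j x) : x ∈ S.closedInterior := by
  obtain ⟨w, hw, rfl⟩ := eq_affineCombination_of_mem_affineSpan_of_fintype hx
  simp_rw [bary_affineCombination S _ hw] at h
  refine ⟨w, hw, fun i ↦ ⟨h i, ?_⟩, rfl⟩
  rw [← hw]
  exact Finset.single_le_sum (fun i _ ↦ h i) (Finset.mem_univ i)

lemma bary_altitudeFoot {i j : Fin (n + 1)} (h : j ≠ i) :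
    bary S j (S.altitudeFoot i) = weight S i j / ⟪grad S i, grad S i⟫ := by
  have h1 : S.altitudeFoot i = S.points i + (-⟪grad S i, grad S i⟫⁻¹) • grad S i := by
    rw [neg_smul, ← sub_altitudeFoot_eq S i]
    abel
  rw [h1, bary_add_smul, bary_point, if_neg h, weight_comm, weight]
  ring

end Gradient

/-! ### Passing to a facet. -/

section Facet

lemma facet_points {n : ℕ} (S : Affine.Simplex ℝ E (n + 1)) (i : Fin (n + 2)) (j : Fin (n + 1)) :
    (facet S i).points j = S.points (i.succAbove j) :=
  S.faceOpposite_point_eq_point_succAbove i j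

variable {n : ℕ} [NeZero n] (S : Affine.Simplex ℝ E (n + 1)) (i : Fin (n + 2))

/-- The facet gradient is the projection of the full gradient onto the orthogonal complement of
`grad S i`: the difference `d` of the two sides annihilates the edges of the facet, hence is
parallel to `grad S i`, but it is also orthogonal to it. -/
lemma grad_facet (j : Fin (n + 1)) :
    grad (facet S i) j = grad S (i.succAbove j) +
      (weight S (i.succAbove j) i / ⟪grad S i, grad S i⟫) • grad S i := by
  have h0 := (inner_grad_self_pos S i).ne'
  set d := grad (facet S i) j - (grad S (i.succAbove j) +
      (weight S (i.succAbove j) i / ⟪grad S i, grad S i⟫) • grad S i) with hd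
  have hmem : d ∈ vectorSpan ℝ (Set.range S.points) := by
    refine Submodule.sub_mem _ ?_ (Submodule.add_mem _ (grad_mem_vectorSpan S _)
      (Submodule.smul_mem _ _ (grad_mem_vectorSpan S _)))
    refine vectorSpan_mono ℝ ?_ (grad_mem_vectorSpan (facet S i) j)
    rintro _ ⟨k, rfl⟩
    exact ⟨_, (facet_points S i k).symm⟩
  have hfac : ∀ a b, ⟪d, S.points (i.succAbove a) - S.points (i.succAbove b)⟫ = 0 := by
    intro a b
    rw [hd, inner_sub_left, inner_add_left, real_inner_smul_left, inner_grad_sub, inner_grad_sub,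
      ← facet_points, ← facet_points, inner_grad_sub]
    simp [Fin.ne_succAbove]
  have hgrad : ⟪grad S i, d⟫ = 0 := by
    have h1 : ⟪grad S i, grad (facet S i) j⟫ = 0 := by
      refine inner_eq_zero_of_mem_vectorSpan (grad_mem_vectorSpan (facet S i) j) fun a b ↦ ?_
      rw [facet_points, facet_points, inner_grad_sub]
      simp [Fin.ne_succAbove]
    rw [hd, inner_sub_right, h1, inner_add_right, real_inner_smul_right, weight_comm, weight]
    field_simp
    ring
  have hmul : d = ⟪d, S.points i - S.points (i.succAbove 0)⟫ • grad S i := by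
    rw [← sub_eq_zero]
    refine eq_zero_of_mem_vectorSpan (p := S.points)
      (Submodule.sub_mem _ hmem (Submodule.smul_mem _ _ (grad_mem_vectorSpan S _))) ?_
    set c := ⟪d, S.points i - S.points (i.succAbove 0)⟫ with hc
    have key : ∀ a, ⟪d - c • grad S i, S.points a - S.points (i.succAbove 0)⟫ = 0 := by
      intro a
      rw [inner_sub_left, real_inner_smul_left, inner_grad_sub]
      rcases Fin.eq_self_or_eq_succAbove i a with rfl | ⟨a, rfl⟩
      · simp [Fin.ne_succAbove, hc]
      · rw [hfac]
        simp [Fin.ne_succAbove]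
    intro a b
    have : S.points a - S.points b = (S.points a - S.points (i.succAbove 0)) -
      (S.points b - S.points (i.succAbove 0)) := by abel
    rw [this, inner_sub_right, key, key, sub_zero]
  have hzero : d = 0 := by
    rw [hmul, real_inner_smul_right] at hgrad
    rw [hmul, (mul_eq_zero.1 hgrad).resolve_right h0, zero_smul]
  exact sub_eq_zero.1 hzero

lemma weight_facet (j k : Fin (n + 1)) :
    weight (facet S i) j k = weight S (i.succAbove j) (i.succAbove k) +
      weight S (i.succAbove j) i * weight S (i.succAbove k) i / ⟪grad S i, grad S i⟫ := by
  have h0 := (inner_grad_self_pos S i).ne'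
  rw [weight, grad_facet, grad_facet]
  simp only [inner_add_left, inner_add_right, real_inner_smul_left, real_inner_smul_right]
  rw [weight_comm S _ i, weight_comm S _ i]
  simp only [weight]
  rw [real_inner_comm (grad S i) (grad S (i.succAbove j))]
  field_simp
  ring

lemma bary_facet (j : Fin (n + 1)) {x : E}
    (hx : x ∈ affineSpan ℝ (Set.range (facet S i).points)) :
    bary (facet S i) j x = bary S (i.succAbove j) x := by
  obtain ⟨w, hw, rfl⟩ := eq_affineCombination_of_mem_affineSpan_of_fintype hx
  rw [bary_affineCombination _ _ hw, Finset.affineCombination_eq_linear_combination _ _ _ hw, bary]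
  have h : ∑ k, w k • (facet S i).points k - S.points (i.succAbove j) =
      ∑ k, w k • (S.points (i.succAbove k) - S.points (i.succAbove j)) := by
    simp [smul_sub, Finset.sum_sub_distrib, ← Finset.sum_smul, hw, facet_points]
  rw [h, inner_sum]
  simp [real_inner_smul_right, inner_grad_sub, mul_sub, Finset.sum_sub_distrib, hw]

lemma bary_facet_altitudeFoot (j : Fin (n + 1)) :
    bary (facet S i) j (S.altitudeFoot i) =
      weight S i (i.succAbove j) / ⟪grad S i, grad S i⟫ := by
  rw [bary_facet S i j (S.altitudeFoot_mem_affineSpan_faceOpposite i),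
    bary_altitudeFoot S (Fin.succAbove_ne i j)]

end Facet

/-! ### Orthocenters and sub-orthocentric points of triangles. -/

section Triangle

variable (Δ : Affine.Simplex ℝ E 2)

lemma sum_fin_three {M : Type*} [AddCommMonoid M] (f : Fin 3 → M) {a b c : Fin 3} (hab : a ≠ b)
    (hac : a ≠ c) (hbc : b ≠ c) : ∑ i, f i = f a + f b + f c := by
  have : (Finset.univ : Finset (Fin 3)) = {a, b, c} := by decide +revert
  rw [this, Finset.sum_insert (by simp [hab, hac]), Finset.sum_pair hbc, add_assoc]

lemma weight_add_weight_pos {a b c : Fin 3} (hab : a ≠ b) (hac : a ≠ c) (hbc : b ≠ c) :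
    0 < weight Δ a b + weight Δ a c := by
  have h := congrArg (fun v ↦ ⟪grad Δ a, v⟫) (sum_grad Δ)
  simp only [sum_fin_three _ hab hac hbc, inner_add_right, inner_zero_right] at h
  have := inner_grad_self_pos Δ a
  simp only [weight]
  linarith

/-- The altitude from `a` has direction `grad Δ a`, along which the coordinates of `b` and `c`
change in the ratio of the weights of ab and ac. -/
lemma bary_orthocenter_mul_weight {a b c : Fin 3} (hab : a ≠ b) (hac : a ≠ c) :
    bary Δ b (Affine.Triangle.orthocenter Δ) * weight Δ a c =
      bary Δ c (Affine.Triangle.orthocenter Δ) * weight Δ a b := by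
  have h := Affine.Triangle.orthocenter_mem_altitude Δ (i₁ := a)
  rw [← Affine.Simplex.affineSpan_pair_altitudeFoot_eq_altitude,
    mem_affineSpan_pair_iff_exists_lineMap_eq] at h
  obtain ⟨r, hr⟩ := h
  have hH : Affine.Triangle.orthocenter Δ =
      Δ.points a + ((r - 1) * ⟪grad Δ a, grad Δ a⟫⁻¹) • grad Δ a := by
    rw [mul_smul, ← sub_altitudeFoot_eq, ← hr, AffineMap.lineMap_apply, vsub_eq_sub, vadd_eq_add]
    module
  rw [hH, bary_add_smul, bary_add_smul, bary_point, bary_point, if_neg hab.symm, if_neg hac.symm,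
    weight_comm Δ a, weight_comm Δ a, weight, weight]
  ring

variable {Δ}

lemma bary_orthocenter_nonneg (hΔ : IsNonobtuse Δ) (a : Fin 3) :
    0 ≤ bary Δ a (Affine.Triangle.orthocenter Δ) := by
  rw [isNonobtuse_iff] at hΔ
  obtain ⟨b, c, hab, hac, hbc⟩ : ∃ b c, a ≠ b ∧ a ≠ c ∧ b ≠ c := by decide +revert
  set H := Affine.Triangle.orthocenter Δ
  have hsum := sum_bary Δ (Affine.Triangle.orthocenter_mem_affineSpan Δ)
  rw [sum_fin_three _ hab hac hbc] at hsum
  have h1 := bary_orthocenter_mul_weight Δ hab.symm hbc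
  have h2 := bary_orthocenter_mul_weight Δ hac.symm hbc.symm
  have hb := weight_add_weight_pos Δ hab.symm hbc hac
  have hc := weight_add_weight_pos Δ hac.symm hbc.symm hab
  rw [weight_comm Δ c b] at h2 hc
  rw [weight_comm Δ b a] at h1 hb
  rw [weight_comm Δ c a] at h2 hc
  have wab := hΔ a b hab
  have wac := hΔ a c hac
  have wbc := hΔ b c hbc
  by_contra! h
  -- Weight zero on bc is the right-angled case: the orthocenter is the vertex `a`. Otherwise a
  -- negative coordinate makes all three negative, although they sum to 1.
  rcases wbc.eq_or_lt with h0 | h0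
  · rw [← h0] at h1 h2 hb hc
    have hB : bary Δ b H = 0 := by
      have : bary Δ b H * weight Δ a c = 0 := by linarith
      exact (mul_eq_zero.1 this).resolve_right (by linarith)
    have hC : bary Δ c H = 0 := by
      have : bary Δ c H * weight Δ a b = 0 := by linarith
      exact (mul_eq_zero.1 this).resolve_right (by linarith)
    linarith
  · have h3 : bary Δ a H * weight Δ b c < 0 := mul_neg_of_neg_of_pos h h0
    have hB : bary Δ b H < 0 := by
      by_contra! h'
      have := mul_nonneg h' wac
      linarith
    have hC : bary Δ c H < 0 := by
      by_contra! h'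
      have := mul_nonneg h' wab
      linarith
    linarith

lemma bary_nonneg_of_mem_triangleSubOrthocentricSet (hΔ : IsNonobtuse Δ) {x : E}
    (hx : x ∈ triangleSubOrthocentricSet Δ) (j : Fin 3) : 0 ≤ bary Δ j x := by
  obtain ⟨a, s, t, hs, ht, hst, rfl⟩ := Set.mem_iUnion.1 hx
  rw [bary_combo Δ j _ _ hst, bary_point]
  have := bary_orthocenter_nonneg hΔ j
  split_ifs <;> positivity

/-- The three products of a coordinate with the weight of the opposite edge agree at the
orthocenter; moving towards a vertex raises that vertex's product relative to the other two, which
stay equal. So no product is strictly smallest. -/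
lemma bary_mul_weight_le_of_mem_triangleSubOrthocentricSet (hΔ : IsNonobtuse Δ) {x : E}
    (hx : x ∈ triangleSubOrthocentricSet Δ) {j k l : Fin 3} (hjk : j ≠ k) (hjl : j ≠ l)
    (hkl : k ≠ l) :
    bary Δ k x * weight Δ j l ≤ bary Δ j x * weight Δ k l ∨
      bary Δ l x * weight Δ j k ≤ bary Δ j x * weight Δ k l := by
  rw [isNonobtuse_iff] at hΔ
  obtain ⟨a, s, t, hs, ht, hst, rfl⟩ := Set.mem_iUnion.1 hx
  simp only [bary_combo Δ _ _ _ hst, bary_point]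
  have h1 := bary_orthocenter_mul_weight Δ hkl.symm hjl.symm
  have h2 := bary_orthocenter_mul_weight Δ hkl hjk.symm
  rw [weight_comm Δ l j, weight_comm Δ l k] at h1
  rw [weight_comm Δ k j] at h2
  have h1 := congrArg (t * ·) h1
  have h2 := congrArg (t * ·) h2
  have hcases : ∀ a j k l : Fin 3, j ≠ k → j ≠ l → k ≠ l → a = j ∨ a = k ∨ a = l := by decide
  obtain rfl | rfl | rfl := hcases a j k l hjk hjl hkl
  · left
    have := mul_nonneg hs (hΔ k l hkl)
    simp only [if_true, if_neg hjk.symm]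
    linarith
  · right
    simp only [if_neg hjk, if_neg hkl.symm]
    linarith
  · left
    simp only [if_neg hjl, if_neg hkl]
    linarith

end Triangle

/-! ### Weights of sub-orthocentric tetrahedra. -/

section Tetrahedron

variable {T : Affine.Simplex ℝ E 3}

lemma IsSubOrthocentricTetrahedron.weight_nonneg (hT : IsSubOrthocentricTetrahedron T)
    {i j : Fin 4} (hij : i ≠ j) : 0 ≤ weight T i j := by
  obtain ⟨j, rfl⟩ := Fin.exists_succAbove_eq hij.symm
  have h := bary_nonneg_of_mem_triangleSubOrthocentricSet (hT.1 i) (hT.2 i) j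
  rw [bary_facet_altitudeFoot, le_div_iff₀ (inner_grad_self_pos T i)] at h
  linarith

/-- This is the triangle inequality above at the foot from `i`; the corrections in the facet weights
all contribute the same symmetric term in `j`, `k`, `l`, which cancels. -/
lemma IsSubOrthocentricTetrahedron.weight_mul_weight_le (hT : IsSubOrthocentricTetrahedron T)
    {i j k l : Fin 4} (hij : i ≠ j) (hik : i ≠ k) (hil : i ≠ l) (hjk : j ≠ k) (hjl : j ≠ l)
    (hkl : k ≠ l) :
    weight T i k * weight T j l ≤ weight T i j * weight T k l ∨
      weight T i l * weight T j k ≤ weight T i j * weight T k l := by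
  obtain ⟨j, rfl⟩ := Fin.exists_succAbove_eq hij.symm
  obtain ⟨k, rfl⟩ := Fin.exists_succAbove_eq hik.symm
  obtain ⟨l, rfl⟩ := Fin.exists_succAbove_eq hil.symm
  rw [Ne, Fin.succAbove_right_inj] at hjk hjl hkl
  have h := bary_mul_weight_le_of_mem_triangleSubOrthocentricSet (hT.1 i) (hT.2 i) hjk hjl hkl
  simp only [bary_facet_altitudeFoot, weight_facet] at h
  have hD := inner_grad_self_pos T i
  set D := ⟪grad T i, grad T i⟫
  simp only [weight_comm T _ i] at h
  refine h.imp (fun h ↦ ?_) (fun h ↦ ?_)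
  all_goals
    have h := mul_le_mul_of_nonneg_right h hD.le
    field_simp at h
    refine le_of_mul_le_mul_right ?_ hD
    linarith

end Tetrahedron

/-! ### Weights of 4-simplices with sub-orthocentric facets. -/

section FourSimplex

variable {S : Affine.Simplex ℝ E 4}

lemma exists_three_others {i j : Fin 5} (hij : i ≠ j) :
    ∃ p q r : Fin 5, (p ≠ i ∧ p ≠ j) ∧ (q ≠ i ∧ q ≠ j ∧ q ≠ p) ∧
      (r ≠ i ∧ r ≠ j ∧ r ≠ p ∧ r ≠ q) := by
  decide +revert

lemma exists_fifth (i j k l : Fin 5) : ∃ m : Fin 5, m ≠ i ∧ m ≠ j ∧ m ≠ k ∧ m ≠ l := by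
  decide +revert

lemma facet_weight_nonneg (hS : ∀ i, IsSubOrthocentricTetrahedron (facet S i)) {m i j : Fin 5}
    (hi : i ≠ m) (hj : j ≠ m) (hij : i ≠ j) :
    0 ≤ weight S i j + weight S i m * weight S j m / ⟪grad S m, grad S m⟫ := by
  obtain ⟨i, rfl⟩ := Fin.exists_succAbove_eq hi
  obtain ⟨j, rfl⟩ := Fin.exists_succAbove_eq hj
  rw [← weight_facet]
  exact (hS m).weight_nonneg fun h ↦ hij (congrArg _ h)

lemma facet_weight_mul_le (hS : ∀ i, IsSubOrthocentricTetrahedron (facet S i))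
    {m i j k l : Fin 5} (hi : i ≠ m) (hj : j ≠ m) (hk : k ≠ m) (hl : l ≠ m) (hij : i ≠ j)
    (hik : i ≠ k) (hil : i ≠ l) (hjk : j ≠ k) (hjl : j ≠ l) (hkl : k ≠ l) :
    (weight S i k + weight S i m * weight S k m / ⟪grad S m, grad S m⟫) *
        (weight S j l + weight S j m * weight S l m / ⟪grad S m, grad S m⟫) ≤
      (weight S i j + weight S i m * weight S j m / ⟪grad S m, grad S m⟫) *
        (weight S k l + weight S k m * weight S l m / ⟪grad S m, grad S m⟫) ∨
    (weight S i l + weight S i m * weight S l m / ⟪grad S m, grad S m⟫) *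
        (weight S j k + weight S j m * weight S k m / ⟪grad S m, grad S m⟫) ≤
      (weight S i j + weight S i m * weight S j m / ⟪grad S m, grad S m⟫) *
        (weight S k l + weight S k m * weight S l m / ⟪grad S m, grad S m⟫) := by
  obtain ⟨i, rfl⟩ := Fin.exists_succAbove_eq hi
  obtain ⟨j, rfl⟩ := Fin.exists_succAbove_eq hj
  obtain ⟨k, rfl⟩ := Fin.exists_succAbove_eq hk
  obtain ⟨l, rfl⟩ := Fin.exists_succAbove_eq hl
  rw [Ne, Fin.succAbove_right_inj] at hij hik hil hjk hjl hkl
  simp only [← weight_facet]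
  exact (hS m).weight_mul_weight_le hij hik hil hjk hjl hkl

/-- Strict Cauchy–Schwarz, read off from the positive squared length of the facet gradient. -/
lemma weight_mul_self_lt {n : ℕ} [NeZero n] (S : Affine.Simplex ℝ E (n + 1)) {i m : Fin (n + 2)}
    (hi : i ≠ m) :
    weight S i m * weight S i m < ⟪grad S i, grad S i⟫ * ⟪grad S m, grad S m⟫ := by
  obtain ⟨i, rfl⟩ := Fin.exists_succAbove_eq hi
  have h := inner_grad_self_pos (facet S m) i
  have hD := inner_grad_self_pos S m
  have h' : weight (facet S m) i i < 0 := neg_lt_zero.2 h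
  rw [weight_facet, weight, ← lt_neg_iff_add_neg', neg_neg, div_lt_iff₀ hD] at h'
  exact h'

lemma weight_pos_of_weight_neg (hS : ∀ i, IsSubOrthocentricTetrahedron (facet S i))
    {i j x : Fin 5} (hij : i ≠ j) (hxi : x ≠ i) (hxj : x ≠ j) (h : weight S i j < 0) :
    0 < weight S i x ∧ 0 < weight S j x := by
  have h1 := facet_weight_nonneg hS hxi.symm hxj.symm hij
  have h2 := facet_weight_nonneg hS hij hxj hxi.symm
  have h3 := weight_mul_self_lt S hxj.symm
  have hx := inner_grad_self_pos S x
  have hj := inner_grad_self_pos S j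
  have hprod : 0 < weight S i x * weight S j x := by
    by_contra! h'
    have := div_nonpos_of_nonpos_of_nonneg h' hx.le
    linarith
  rcases mul_pos_iff.1 hprod with h4 | ⟨h4, h5⟩
  · exact h4
  -- If both weights were negative, multiplying the inequalities from the facets opposite `x` and
  -- `j` would contradict strict Cauchy–Schwarz for `j`, `x`.
  · exfalso
    rw [weight_comm S x j] at h2
    have h1' : -weight S i j * ⟪grad S x, grad S x⟫ ≤ weight S i x * weight S j x := by
      rw [← le_div_iff₀ hx]
      linarith
    have h2' : -weight S i x * ⟪grad S j, grad S j⟫ ≤ weight S i j * weight S j x := by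
      rw [← le_div_iff₀ hj]
      linarith
    have h6 := mul_le_mul h1' h2' (mul_nonneg (by linarith) hj.le) hprod.le
    have h7 := mul_lt_mul_of_pos_left h3 (mul_pos_of_neg_of_neg h h4)
    linarith

/-- In `strict_of_facet`, `t` is the squared gradient at the omitted vertex p, `e` = w_ij, `a` =
w_qr; `u`, `v` join p to i, j and `b`, `c` join p to q, r (in the first alternative). After
expansion the terms in 1/t² cancel. -/
lemma strict_of_facet_inequality {t e a b c u u' v v' : ℝ} (ht : 0 < t) (hu : 0 < u) (hv : 0 < v)
    (hb : 0 ≤ b) (hc : 0 ≤ c) (h1 : e * a < u' * v') (h2 : e * b < u' * v) (h3 : e * c < u * v')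
    (h : (u' + u * b / t) * (v' + v * c / t) ≤ (e + u * v / t) * (a + b * c / t)) :
    v' * b < a * v ∧ u' * c < a * u := by
  have h' : u' * v' + (u' * v * c + v' * u * b) / t ≤ e * a + (e * b * c + a * u * v) / t := by
    have e1 : (u' + u * b / t) * (v' + v * c / t) =
      u' * v' + (u' * v * c + v' * u * b) / t + u * v * b * c / t / t := by ring
    have e2 : (e + u * v / t) * (a + b * c / t) =
      e * a + (e * b * c + a * u * v) / t + u * v * b * c / t / t := by ring
    linarith
  have h4 : u' * v * c + v' * u * b < e * b * c + a * u * v := by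
    rw [← div_lt_div_iff_of_pos_right ht]
    linarith
  have h5 := mul_le_mul_of_nonneg_right h2.le hc
  have h6 := mul_le_mul_of_nonneg_right h3.le hb
  constructor
  · refine lt_of_mul_lt_mul_right ?_ hu.le
    linarith
  · refine lt_of_mul_lt_mul_right ?_ hv.le
    linarith

lemma strict_of_facet (hS : ∀ i, IsSubOrthocentricTetrahedron (facet S i))
    {i j p q r : Fin 5} (hij : i ≠ j) (hpi : p ≠ i) (hpj : p ≠ j) (hqi : q ≠ i) (hqj : q ≠ j)
    (hri : r ≠ i) (hrj : r ≠ j) (hpq : p ≠ q) (hpr : p ≠ r) (hqr : q ≠ r)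
    (hu : ∀ x, x ≠ i → x ≠ j → 0 < weight S i x ∧ 0 < weight S j x)
    (ha : ∀ x y, x ≠ i → x ≠ j → y ≠ i → y ≠ j → x ≠ y → 0 ≤ weight S x y)
    (h : ∀ x y, x ≠ i → x ≠ j → y ≠ i → y ≠ j → x ≠ y →
      weight S i j * weight S x y < weight S i x * weight S j y) :
    (weight S j r * weight S p q < weight S q r * weight S j p ∧
      weight S i q * weight S p r < weight S q r * weight S i p) ∨
    (weight S j q * weight S p r < weight S q r * weight S j p ∧
      weight S i r * weight S p q < weight S q r * weight S i p) := by
  have hD := inner_grad_self_pos S p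
  have h0 := facet_weight_mul_le hS hpi.symm hpj.symm hpq.symm hpr.symm hij hqi.symm hri.symm
    hqj.symm hrj.symm hqr
  rw [weight_comm S q p, weight_comm S r p] at h0
  have hpq' := ha p q hpi hpj hqi hqj hpq
  have hpr' := ha p r hpi hpj hri hrj hpr
  refine h0.imp (fun h0 ↦ ?_) (fun h0 ↦ ?_)
  · refine strict_of_facet_inequality hD (hu p hpi hpj).1 (hu p hpi hpj).2 hpq' hpr'
      (h q r hqi hqj hri hrj hqr) ?_ (h p r hpi hpj hri hrj hpr) h0
    rw [weight_comm S p q]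
    exact h q p hqi hqj hpi hpj hpq.symm
  · refine strict_of_facet_inequality (e := weight S i j) hD (hu p hpi hpj).1 (hu p hpi hpj).2 hpr'
      hpq' ?_ ?_ (h p q hpi hpj hqi hqj hpq) ?_
    · rw [weight_comm S q r]
      exact h r q hri hrj hqi hqj hqr.symm
    · rw [weight_comm S p r]
      exact h r p hri hrj hpi hpj hpr.symm
    · rw [mul_comm (weight S p r)]
      exact h0

/-- No edge of a 4-simplex with sub-orthocentric facets is, in each quadrilateral of the remaining
vertices, in the strictly smallest pair of opposite edges. -/
lemma not_forall_weight_mul_lt (hS : ∀ i, IsSubOrthocentricTetrahedron (facet S i))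
    {i j : Fin 5} (hij : i ≠ j)
    (hu : ∀ x, x ≠ i → x ≠ j → 0 < weight S i x ∧ 0 < weight S j x)
    (ha : ∀ x y, x ≠ i → x ≠ j → y ≠ i → y ≠ j → x ≠ y → 0 ≤ weight S x y)
    (h : ∀ x y, x ≠ i → x ≠ j → y ≠ i → y ≠ j → x ≠ y →
      weight S i j * weight S x y < weight S i x * weight S j y) : False := by
  obtain ⟨p, q, r, ⟨hpi, hpj⟩, ⟨hqi, hqj, hqp⟩, hri, hrj, hrp, hrq⟩ := exists_three_others hij
  have h1 := strict_of_facet hS hij hpi hpj hqi hqj hri hrj hqp.symm hrp.symm hrq.symm hu ha h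
  have h2 := strict_of_facet hS hij hqi hqj hri hrj hpi hpj hrq.symm hqp hrp hu ha h
  have h3 := strict_of_facet hS hij hri hrj hpi hpj hqi hqj hrp hrq hqp.symm hu ha h
  rw [weight_comm S q p, weight_comm S r p] at h2
  rw [weight_comm S r q, weight_comm S r p] at h3
  -- Among the three numbers w_jp w_qr, w_jq w_pr, w_jr w_pq, each would strictly exceed another, so
  -- there would be no minimum.
  rcases h1 with h1 | h1 <;> rcases h2 with h2 | h2 <;> rcases h3 with h3 | h3 <;> linarith

lemma weight_nonneg_of_facets (hS : ∀ i, IsSubOrthocentricTetrahedron (facet S i))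
    {i j : Fin 5} (hij : i ≠ j) : 0 ≤ weight S i j := by
  by_contra! hneg
  have hu : ∀ x, x ≠ i → x ≠ j → 0 < weight S i x ∧ 0 < weight S j x :=
    fun x hi hj ↦ weight_pos_of_weight_neg hS hij hi hj hneg
  have ha : ∀ x y, x ≠ i → x ≠ j → y ≠ i → y ≠ j → x ≠ y → 0 ≤ weight S x y := by
    intro x y hxi hxj hyi hyj hxy
    by_contra! hneg'
    obtain ⟨z, hzi, hzj, hzx, hzy⟩ := exists_fifth i j x y
    have hD := inner_grad_self_pos S z
    obtain ⟨hiz, hjz⟩ := hu z hzi hzj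
    obtain ⟨hix, hjx⟩ := hu x hxi hxj
    obtain ⟨hiy, hjy⟩ := hu y hyi hyj
    obtain ⟨hxz, hyz⟩ := weight_pos_of_weight_neg hS hxy hzx hzy hneg'
    -- With two disjoint negative edges, the facet opposite the fifth vertex `z` would have their
    -- product strictly smallest: its factors lie below the pure correction terms, those of the
    -- other products above, and all products of corrections coincide.
    have h1 : (weight S i j + weight S i z * weight S j z / ⟪grad S z, grad S z⟫) *
        (weight S x y + weight S x z * weight S y z / ⟪grad S z, grad S z⟫) ≤
        (weight S i z * weight S j z / ⟪grad S z, grad S z⟫) *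
        (weight S x z * weight S y z / ⟪grad S z, grad S z⟫) :=
      mul_le_mul (by linarith) (by linarith) (facet_weight_nonneg hS hzx.symm hzy.symm hxy)
        (by positivity)
    have h2 : (weight S i z * weight S j z / ⟪grad S z, grad S z⟫) *
        (weight S x z * weight S y z / ⟪grad S z, grad S z⟫) =
        (weight S i z * weight S x z / ⟪grad S z, grad S z⟫) *
        (weight S j z * weight S y z / ⟪grad S z, grad S z⟫) := by ring
    have h3 : (weight S i z * weight S j z / ⟪grad S z, grad S z⟫) *
        (weight S x z * weight S y z / ⟪grad S z, grad S z⟫) =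
        (weight S i z * weight S y z / ⟪grad S z, grad S z⟫) *
        (weight S j z * weight S x z / ⟪grad S z, grad S z⟫) := by ring
    rcases facet_weight_mul_le hS hzi.symm hzj.symm hzx.symm hzy.symm hij hxi.symm hyi.symm
      hxj.symm hyj.symm hxy with h | h
    · refine absurd (h.trans (h1.trans h2.le)) (not_le.2 ?_)
      refine mul_lt_mul'' ?_ ?_ (by positivity) (by positivity) <;> linarith
    · refine absurd (h.trans (h1.trans h3.le)) (not_le.2 ?_)
      refine mul_lt_mul'' ?_ ?_ (by positivity) (by positivity) <;> linarith
  refine not_forall_weight_mul_lt hS hij hu ha fun x y hxi hxj hyi hyj hxy ↦ ?_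
  exact (mul_nonpos_of_nonpos_of_nonneg hneg.le (ha x y hxi hxj hyi hyj hxy)).trans_lt
    (mul_pos (hu x hxi hxj).1 (hu y hyi hyj).2)

end FourSimplex

/-! ### Inequalities on the removed part of a tetrahedron. -/

section Core

variable {T : Affine.Simplex ℝ E 3}

lemma exists_pos_add_smul_mem {A : Set E} {y v : E} (hy : y ∈ interiorIn T A)
    (hv : v ∈ vectorSpan ℝ (Set.range T.points)) : ∃ t : ℝ, 0 < t ∧ y + (-t) • v ∈ A := by
  obtain ⟨⟨y, hmem⟩, hz, rfl⟩ := hy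
  have hm : ∀ t : ℝ, y + (-t) • v ∈ affineSpan ℝ (Set.range T.points) := fun t ↦ by
    rw [add_comm y]
    refine AffineSubspace.vadd_mem_of_mem_direction ?_ hmem
    rw [direction_affineSpan]
    exact Submodule.smul_mem _ _ hv
  let γ : ℝ → affineSpan ℝ (Set.range T.points) := fun t ↦ ⟨y + (-t) • v, hm t⟩
  have hγ : Continuous γ := Continuous.subtype_mk (by fun_prop) _
  have h0 : γ 0 ∈ interior (Subtype.val ⁻¹' A : Set (affineSpan ℝ (Set.range T.points))) := by
    convert! hz using 1
    simp [γ]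
  have hopen := (isOpen_interior.preimage hγ).mem_nhds h0
  obtain ⟨ε, hε, hball⟩ := Metric.mem_nhds_iff.1 hopen
  refine ⟨ε / 2, by positivity, ?_⟩
  have : γ (ε / 2) ∈ interior (Subtype.val ⁻¹' A : Set (affineSpan ℝ (Set.range T.points))) :=
    hball (by
      rw [Metric.mem_ball, Real.dist_eq, sub_zero, abs_of_pos (by positivity)]
      linarith)
  exact interior_subset (s := Subtype.val ⁻¹' A) this

lemma bary_nonneg_of_mem_subTetrahedron (hT : IsNonobtuse T) {j l : Fin 4} (hjl : j ≠ l) {x : E}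
    (hx : x ∈ subTetrahedron T j l) : 0 ≤ bary T l x := by
  rw [isNonobtuse_iff] at hT
  have hconv : Convex ℝ {x | 0 ≤ bary T l x} := by
    intro x hx y hy s t hs ht hst
    simp only [Set.mem_ofPred_eq] at hx hy ⊢
    rw [bary_combo T l x y hst]
    positivity
  refine convexHull_min ?_ hconv hx
  rintro _ (rfl | ⟨k, rfl⟩)
  · rw [Set.mem_ofPred_eq, bary_altitudeFoot T hjl.symm]
    exact div_nonneg (hT j l hjl) (inner_grad_self_pos T j).le
  · rw [Set.mem_ofPred_eq, facet_points, bary_point]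
    split_ifs <;> simp

/-- It suffices to check generators: equality holds at the foot, whose coordinates are proportional
to the weights at `j`, and on the facet the `l`-th coordinate vanishes. -/
lemma weight_mul_bary_le_of_mem_subTetrahedron (hT : IsNonobtuse T) {i j l : Fin 4} (hij : i ≠ j)
    (hjl : j ≠ l) {x : E} (hx : x ∈ subTetrahedron T j l) :
    weight T j i * bary T l x ≤ weight T j l * bary T i x := by
  rw [isNonobtuse_iff] at hT
  have hconv : Convex ℝ {x | weight T j i * bary T l x ≤ weight T j l * bary T i x} := by
    intro x hx y hy s t hs ht hst
    simp only [Set.mem_ofPred_eq] at hx hy ⊢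
    rw [bary_combo T l x y hst, bary_combo T i x y hst]
    have h1 := mul_le_mul_of_nonneg_left hx hs
    have h2 := mul_le_mul_of_nonneg_left hy ht
    linarith
  refine convexHull_min ?_ hconv hx
  rintro _ (rfl | ⟨k, rfl⟩)
  · rw [Set.mem_ofPred_eq, bary_altitudeFoot T hjl.symm, bary_altitudeFoot T hij]
    exact le_of_eq (by ring)
  · have := hT j l hjl
    rw [Set.mem_ofPred_eq, facet_points, bary_point, bary_point, if_neg (Fin.ne_succAbove l k),
      mul_zero]
    split_ifs <;> simp [this]

lemma bary_pos_of_mem_interiorIn (hT : IsNonobtuse T) {l : Fin 4} {y : E}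
    (hy : y ∈ interiorIn T (coreTetrahedron T l)) : 0 < bary T l y := by
  obtain ⟨t, ht, hmem⟩ := exists_pos_add_smul_mem hy (grad_mem_vectorSpan T l)
  obtain ⟨j, hj⟩ := exists_ne l
  have h := bary_nonneg_of_mem_subTetrahedron hT hj (Set.mem_iInter₂.1 hmem j hj)
  rw [bary_add_smul] at h
  have := mul_pos ht (inner_grad_self_pos T l)
  linarith

/-- With weight zero the foot from `j` would lie in the plane of the `l`-th facet, and the
sub-tetrahedron would be flat. -/
lemma weight_pos_of_nonempty (hT : IsNonobtuse T) {j l : Fin 4} (hjl : j ≠ l)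
    (h : (interiorIn T (coreTetrahedron T l)).Nonempty) : 0 < weight T j l := by
  obtain ⟨y, hy⟩ := h
  refine ((isNonobtuse_iff T).1 hT j l hjl).lt_of_ne fun h0 ↦ ?_
  have hpos := bary_pos_of_mem_interiorIn hT hy
  obtain ⟨z, -, rfl⟩ := id hy
  obtain ⟨t, ht, hmem⟩ := exists_pos_add_smul_mem hy (Submodule.zero_mem _)
  rw [smul_zero, add_zero] at hmem
  have hconv : Convex ℝ {x | bary T l x ≤ 0} := by
    intro x hx y hy s t hs ht hst
    simp only [Set.mem_ofPred_eq] at hx hy ⊢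
    rw [bary_combo T l x y hst]
    have := mul_nonpos_of_nonneg_of_nonpos hs hx
    have := mul_nonpos_of_nonneg_of_nonpos ht hy
    linarith
  refine absurd (convexHull_min ?_ hconv (Set.mem_iInter₂.1 hmem j hjl)) (not_le.2 hpos)
  rintro _ (rfl | ⟨k, rfl⟩)
  · rw [Set.mem_ofPred_eq, bary_altitudeFoot T hjl.symm, ← h0, zero_div]
  · rw [Set.mem_ofPred_eq, facet_points, bary_point, if_neg (Fin.ne_succAbove l k)]

lemma weight_mul_bary_lt_of_mem_interiorIn (hT : IsNonobtuse T) {i j l : Fin 4} (hij : i ≠ j)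
    (hil : i ≠ l) (hjl : j ≠ l) {y : E} (hy : y ∈ interiorIn T (coreTetrahedron T l)) :
    weight T j i * bary T l y < weight T j l * bary T i y := by
  have hw := weight_pos_of_nonempty hT hjl ⟨y, hy⟩
  -- `v` is the gradient of the right side minus the left; the weak inequality still holds after a
  -- small step along `-v`, so it is strict at `y`.
  set v := weight T j l • grad T i - weight T j i • grad T l with hv
  have hv0 : v ≠ 0 := by
    intro h0
    have := congrArg (fun u ↦ ⟪u, T.points i - T.points j⟫) h0
    simp only [hv, inner_sub_left, real_inner_smul_left, inner_grad_sub, inner_zero_left] at this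
    simp [hij, hil.symm, hjl.symm] at this
    exact hw.ne' this
  obtain ⟨t, ht, hmem⟩ := exists_pos_add_smul_mem hy (v := v)
    (Submodule.sub_mem _ (Submodule.smul_mem _ _ (grad_mem_vectorSpan T i))
      (Submodule.smul_mem _ _ (grad_mem_vectorSpan T l)))
  have h := weight_mul_bary_le_of_mem_subTetrahedron hT hij hjl (Set.mem_iInter₂.1 hmem j hjl)
  rw [bary_add_smul, bary_add_smul] at h
  have hpos : 0 < t * ⟪v, v⟫ := mul_pos ht (real_inner_self_pos.2 hv0)
  have hvv : ⟪v, v⟫ = weight T j l * ⟪grad T i, v⟫ - weight T j i * ⟪grad T l, v⟫ := by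
    conv_lhs => rw [hv, inner_sub_left, real_inner_smul_left, real_inner_smul_left]
  rw [hvv] at hpos
  linarith

lemma weight_mul_bary_lt_of_mem_interior_facet (hT : IsNonobtuse T) {i j l : Fin 4}
    (hil : i ≠ l) (hjl : j ≠ l) (hne : (interiorIn T (coreTetrahedron T l)).Nonempty) {y : E}
    (hy : y ∈ (facet T l).interior) :
    weight T j i * bary T l y < weight T j l * bary T i y := by
  have hw := weight_pos_of_nonempty hT hjl hne
  obtain ⟨i, rfl⟩ := Fin.exists_succAbove_eq hil
  have hmem : y ∈ affineSpan ℝ (Set.range (facet T l).points) :=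
    Affine.Simplex.setInterior_subset_affineSpan hy
  have hpos : 0 < bary T (l.succAbove i) y := by
    rw [← bary_facet T l i hmem]
    obtain ⟨w, hw1, hw2, rfl⟩ := hy
    rw [bary_affineCombination _ _ hw1]
    exact (hw2 i).1
  have hzero : bary T l y = 0 := by
    have hmem' : y ∈ affineSpan ℝ (Set.range T.points) :=
      Affine.Simplex.affineSpan_faceOpposite_le T l hmem
    have h1 := sum_bary T hmem'
    have h2 := sum_bary (facet T l) hmem
    rw [Fin.sum_univ_succAbove _ l] at h1
    simp_rw [bary_facet T l _ hmem] at h2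
    linarith
  rw [hzero, mul_zero]
  exact mul_pos hw hpos

end Core

end SubOrthocentric

theorem mainTheorem4 {E : Type*} [NormedAddCommGroup E] [InnerProductSpace ℝ E]
    (S : Affine.Simplex ℝ E 4)
    (hS : ∀ i : Fin 5, SubOrthocentric.IsSubOrthocentricTetrahedron (SubOrthocentric.facet S i)) :
    SubOrthocentric.IsSubOrthocentricFourSimplex S := by
  open SubOrthocentric in
  have hT : ∀ i, IsNonobtuse (facet S i) := fun i ↦
    (isNonobtuse_iff _).2 fun j k hjk ↦ (hS i).weight_nonneg hjk
  refine ⟨hT, fun m ↦ ⟨?_, ?_⟩⟩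
  · refine mem_closedInterior_of_bary_nonneg _ (S.altitudeFoot_mem_affineSpan_faceOpposite m) ?_
    intro j
    rw [bary_facet_altitudeFoot]
    exact div_nonneg (weight_nonneg_of_facets hS (Fin.ne_succAbove m j))
      (inner_grad_self_pos S m).le
  · intro hx
    obtain ⟨l, hne, hx⟩ := Set.mem_iUnion₂.1 hx
    have hD := inner_grad_self_pos S m
    have key : ∀ i j, i ≠ j → i ≠ l → j ≠ l →
        weight S m (m.succAbove l) * weight S (m.succAbove j) (m.succAbove i) <
          weight S m (m.succAbove i) * weight S (m.succAbove l) (m.succAbove j) := by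
      intro i j hij hil hjl
      have h : weight (facet S m) j i * bary (facet S m) l (S.altitudeFoot m) <
          weight (facet S m) j l * bary (facet S m) i (S.altitudeFoot m) := by
        rcases hx with hx | hx
        · exact weight_mul_bary_lt_of_mem_interiorIn (hT m) hij hil hjl hx
        · exact weight_mul_bary_lt_of_mem_interior_facet (hT m) hil hjl hne hx
      rw [bary_facet_altitudeFoot, bary_facet_altitudeFoot, weight_facet, weight_facet,
        weight_comm S _ m, weight_comm S _ m, weight_comm S _ m,
        weight_comm S (m.succAbove j) (m.succAbove l), mul_div_assoc', mul_div_assoc',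
        div_lt_div_iff_of_pos_right hD] at h
      -- The facet corrections on both sides are equal, leaving an inequality between weights of
      -- `S`.
      have e : weight S m (m.succAbove j) * weight S m (m.succAbove i) /
          ⟪grad S m, grad S m⟫ * weight S m (m.succAbove l) =
        weight S m (m.succAbove j) * weight S m (m.succAbove l) /
          ⟪grad S m, grad S m⟫ * weight S m (m.succAbove i) := by ring
      linarith
    have hnn : ∀ {x y}, x ≠ y → 0 ≤ weight S x y := fun h ↦ weight_nonneg_of_facets hS h
    have hinj : ∀ {i j}, i ≠ j → m.succAbove i ≠ m.succAbove j :=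
      fun h ↦ Fin.succAbove_right_injective.ne h
    have hpos : ∀ i j, i ≠ j → i ≠ l → j ≠ l →
        0 < weight S m (m.succAbove i) * weight S (m.succAbove l) (m.succAbove j) :=
      fun i j hij hil hjl ↦ (mul_nonneg (hnn (Fin.ne_succAbove m l)) (hnn (hinj hij.symm))).trans_lt
        (key i j hij hil hjl)
    -- The impossible edge joins `m` to `m.succAbove l`.
    refine not_forall_weight_mul_lt hS (Fin.ne_succAbove m l) ?_ (fun x y _ _ _ _ h ↦ hnn h) ?_
    · intro x hxm hxl
      obtain ⟨i, rfl⟩ := Fin.exists_succAbove_eq hxm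
      have hil : i ≠ l := fun h ↦ hxl (congrArg _ h)
      obtain ⟨j, hij, hjl⟩ : ∃ j, i ≠ j ∧ j ≠ l :=
        (show ∀ i l : Fin 4, ∃ j, i ≠ j ∧ j ≠ l by decide) i l
      exact ⟨pos_of_mul_pos_left (hpos i j hij hil hjl) (hnn (hinj hjl.symm)),
        pos_of_mul_pos_right (hpos j i hij.symm hjl hil) (hnn (Fin.ne_succAbove m j))⟩
    · intro x y hxm hxl hym hyl hxy
      obtain ⟨i, rfl⟩ := Fin.exists_succAbove_eq hxm
      obtain ⟨j, rfl⟩ := Fin.exists_succAbove_eq hym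
      rw [weight_comm S (m.succAbove i)]
      exact key i j (fun h ↦ hxy (congrArg _ h)) (fun h ↦ hxl (congrArg _ h))
        (fun h ↦ hyl (congrArg _ h))
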